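/- All graphs are finite and simple. For a graph $G$ and distinct vertices $u,v$, a set $F\subseteq E(G)$ separates $u$ and $v$ if they lie in different connected components of $G-F$. Let $\lambda(u,v)$ be the minimum number of edges in a set that separates $u$ and $v$, and let the upper edge-connectivity be $\lambda^+(G)=\max\{\lambda(u,v): u,v\in V(G),\ u\neq v\}$ (with $\lambda^+(G)=0$ if $G$ has at most one vertex). An edge-coloring $c:E(G)\to\{1,\dots,k\}$, in which adjacent edges may receive the same color, is a rainbow disconnection coloring if for any two distinct vertices $u,v$ there is a set of edges that separates $u$ and $v$ and no two of whose edges have the same color. The rainbow disconnection number $\mathrm{rd}(G)$ is the smallest $k$ for which such a coloring exists. Corollary. Every graph $G$ of order $n\leq 7$ satisfies $\mathrm{rd}(G)\leq \lambda^+(G)+1$. -/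

import Mathlib

namespace SimpleGraph

variable {V : Type*} (G : SimpleGraph V)

/-- A set `F` of edges of `G` separates `u` and `v` if `u` and `v` lie in different connected
components of `G - F`. -/
def EdgeSeparates (F : Set G.edgeSet) (u v : V) : Prop :=
  ¬ (G.deleteEdges (Subtype.val '' F)).Reachable u v

/-- The local edge-connectivity `λ(u, v)` (for `u ≠ v`): the minimum number of edges of `G` in a
set of edges that separates `u` and `v`. -/
noncomputable def localEdgeConn (u v : V) : ℕ :=
  sInf {m : ℕ | ∃ F : Finset G.edgeSet, F.card = m ∧ G.EdgeSeparates (F : Set G.edgeSet) u v}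

/-- The upper edge-connectivity `λ⁺(G)`: the maximum of `λ(u, v)` over all pairs of distinct
vertices (and `0` if there are no such pairs). -/
noncomputable def upperEdgeConn : ℕ :=
  sSup {m : ℕ | ∃ u v : V, u ≠ v ∧ G.localEdgeConn u v = m}

variable {G} in
/-- An edge-coloring (adjacent edges may be colored the same) is a rainbow disconnection coloring
if any two distinct vertices are separated by a set of edges no two of which have the same
color. -/
def IsRainbowDisconnection {K : Type*} (c : G.edgeSet → K) : Prop :=
  ∀ u v : V, u ≠ v → ∃ R : Set G.edgeSet, Set.InjOn c R ∧ G.EdgeSeparates R u v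

/-- The rainbow disconnection number `rd(G)`: the smallest number of colors in a rainbow
disconnection coloring of `G`. -/
noncomputable def rainbowDisconnectionNumber : ℕ :=
  sInf {k : ℕ | ∃ c : G.edgeSet → Fin k, IsRainbowDisconnection c}

theorem edgeSeparates_univ {u v : V} (h : u ≠ v) : G.EdgeSeparates Set.univ u v := by
  simp [EdgeSeparates, h]

/-- The minimum in the definition of `λ(u, v)` is over a nonempty set. -/
theorem localEdgeConn_spec [Finite V] {u v : V} (h : u ≠ v) :
    ∃ F : Finset G.edgeSet, F.card = G.localEdgeConn u v ∧
      G.EdgeSeparates (F : Set G.edgeSet) u v := by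
  have := Fintype.ofFinite G.edgeSet
  refine Nat.sInf_mem (s := {m : ℕ | ∃ F : Finset G.edgeSet, F.card = m ∧
    G.EdgeSeparates (F : Set G.edgeSet) u v}) ⟨_, Finset.univ, rfl, ?_⟩
  simpa using G.edgeSeparates_univ h

/-- The maximum in the definition of `λ⁺(G)` is over a bounded set. -/
theorem localEdgeConn_le_upperEdgeConn [Finite V] {u v : V} (h : u ≠ v) :
    G.localEdgeConn u v ≤ G.upperEdgeConn := by
  refine le_csSup (Set.Finite.bddAbove ?_) ⟨u, v, h, rfl⟩
  refine (Set.finite_range fun p : V × V => G.localEdgeConn p.1 p.2).subset ?_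
  rintro _ ⟨x, y, -, rfl⟩
  exact ⟨(x, y), rfl⟩

/-- The minimum in the definition of `rd(G)` is over a nonempty set. -/
theorem rainbowDisconnectionNumber_spec [Finite V] :
    ∃ c : G.edgeSet → Fin G.rainbowDisconnectionNumber, IsRainbowDisconnection c :=
  Nat.sInf_mem (s := {k : ℕ | ∃ c : G.edgeSet → Fin k, IsRainbowDisconnection c})
    ⟨_, Finite.equivFin G.edgeSet, fun _ _ h =>
      ⟨Set.univ, (Finite.equivFin G.edgeSet).injective.injOn, G.edgeSeparates_univ h⟩⟩

end SimpleGraph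

/-!
Write `k = λ⁺(G)` and call a vertex *large* if its degree exceeds `k`. Edges are coloured with
`k + 1` colours by a function on `Sym2 V`, and separating edge sets are taken to be the edge
boundaries `edgeCut G S` of vertex sets `S`; the hypothesis `λ⁺(G) ≤ k` becomes `CutBounded G k`,
which passes to subgraphs.

By induction on the number of edges there is a colouring (`CutBounded.exists_isStrongRainbow`) in
which any two vertices are separated by a rainbow boundary, and in which moreover every vertex that
is not large has a rainbow star.

* If at most one vertex is large, it suffices that all other stars are rainbow. This is Vizing's
  theorem with an independent set of unconstrained vertices (`exists_properOff`), proved by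
  shifting a single uncoloured edge around a fan and using Kempe chains.
* If there are two large vertices, a set `S` with at most `k` boundary edges separates them, and
  since `|V| ≤ 7` one of `S` and `Sᶜ` has at most three vertices. Counting degrees, this side is a
  triangle `w, a, b` with `w` large, `a` of degree two and `b` of degree two or three, unless `G`
  has a vertex of degree one (`exists_triangle_of_edgeCut_le`).
* A vertex `a` of degree one, or one in a triangle with `b` of degree two, is deleted, and the
  colouring of the rest extends directly.
* If `b` has degree three (`IsEar`), then `w` has degree `k + 1`, so after the deletion of `a` it is
  no longer large and its star is rainbow. One colour is missing there, and it lets one of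
  `{w, a}` and `{w, a, b}` have a rainbow boundary (`IsEar.exists_extension`). The
  boundary separates `w` from every vertex other than `a` and `b`, whose own stars are rainbow.
* Two large vertices outside `{w, a, b}` would not be separated by this argument. But then one of
  them is the apex of a second ear disjoint from the first, both ears are treated at once, and at
  most one of the seven vertices remains, so every pair is separated
  (`exists_isStrongRainbow_of_two_ears`).
-/

namespace SimpleGraph

variable {V K : Type*} {G H : SimpleGraph V} {c c' : Sym2 V → K} {I : Set V} {α β γ : K}
  {a b u v w x y z : V} {k : ℕ}

/-! ### Colourings with rainbow stars and Kempe chains -/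

/-- The edges of `G` at `v` have distinct colours. Colours are given to all of `Sym2 V`; those of
non-edges play no role. -/
def RainbowAt (G : SimpleGraph V) (c : Sym2 V → K) (v : V) : Prop :=
  Set.InjOn (fun a => c s(v, a)) (G.neighborSet v)

/-- No edge of `G` at `v` has colour `γ`. -/
def MissesAt (G : SimpleGraph V) (c : Sym2 V → K) (v : V) (γ : K) : Prop :=
  ∀ a, G.Adj v a → c s(v, a) ≠ γ

/-- The colouring is proper at every vertex outside `I`; the vertices of `I` are unconstrained. -/
def ProperOff (G : SimpleGraph V) (c : Sym2 V → K) (I : Set V) : Prop :=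
  ∀ v, v ∉ I → G.RainbowAt c v

/-- The graph of the `α`- and `β`-coloured edges with no endpoint in `I`. Its components are the
Kempe chains. Edges at `I` are left out because `I` imposes no constraint, so chains end there. -/
def kempeGraph (G : SimpleGraph V) (c : Sym2 V → K) (I : Set V) (α β : K) : SimpleGraph V where
  Adj a b := G.Adj a b ∧ a ∉ I ∧ b ∉ I ∧ (c s(a, b) = α ∨ c s(a, b) = β)
  symm := ⟨fun a b h => ⟨h.1.symm, h.2.2.1, h.2.1, by rw [Sym2.eq_swap]; exact h.2.2.2⟩⟩
  loopless := ⟨fun a h => G.loopless.irrefl a h.1⟩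


theorem RainbowAt.mono (h : G.RainbowAt c v) (hle : H ≤ G) : H.RainbowAt c v :=
  Set.InjOn.mono (fun _ ha => hle ha) h

theorem MissesAt.mono (h : G.MissesAt c v γ) (hle : H ≤ G) : H.MissesAt c v γ :=
  fun a ha => h a (hle ha)

theorem RainbowAt.of_eq (h : H.RainbowAt c v) (hadj : ∀ a, G.Adj v a → H.Adj v a)
    (hc : ∀ a, G.Adj v a → c' s(v, a) = c s(v, a)) : G.RainbowAt c' v := by
  intro a ha b hb hab
  have hab' : c' s(v, a) = c' s(v, b) := hab
  rw [hc a ha, hc b hb] at hab'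
  exact h (hadj a ha) (hadj b hb) hab'

theorem exists_missesAt [Finite V] [Fintype K] (G : SimpleGraph V) (c : Sym2 V → K) (v : V)
    (h : (G.neighborSet v).ncard < Fintype.card K) : ∃ γ, G.MissesAt c v γ := by
  have hlt : ((fun a => c s(v, a)) '' G.neighborSet v).ncard < (Set.univ : Set K).ncard := by
    rw [Set.ncard_univ, Nat.card_eq_fintype_card]
    exact (Set.ncard_image_le (Set.toFinite _)).trans_lt h
  obtain ⟨γ, -, hγ⟩ := Set.exists_mem_notMem_of_ncard_lt_ncard hlt (Set.toFinite _)
  exact ⟨γ, fun a ha h => hγ ⟨a, ha, h⟩⟩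

theorem RainbowAt.update [DecidableEq (Sym2 V)] (h : H.RainbowAt c x) (hm : H.MissesAt c x γ)
    (hH : ∀ a b, G.Adj a b → s(a, b) ≠ s(x, y) → H.Adj a b) :
    G.RainbowAt (Function.update c s(x, y) γ) x := by
  intro a ha b hb hab
  simp only [Function.update_apply] at hab
  by_cases hay : a = y <;> by_cases hby : b = y
  · rw [hay, hby]
  · subst hay
    have hne : s(x, b) ≠ s(x, a) := mt Sym2.congr_right.1 hby
    rw [if_pos rfl, if_neg hne] at hab
    exact absurd hab.symm (hm b (hH _ _ hb hne))
  · subst hby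
    have hne : s(x, a) ≠ s(x, b) := mt Sym2.congr_right.1 hay
    rw [if_neg hne, if_pos rfl] at hab
    exact absurd hab (hm a (hH _ _ ha hne))
  · have hne : s(x, b) ≠ s(x, y) := mt Sym2.congr_right.1 hby
    have hne' : s(x, a) ≠ s(x, y) := mt Sym2.congr_right.1 hay
    rw [if_neg hne, if_neg hne'] at hab
    exact h (hH _ _ ha hne') (hH _ _ hb hne) hab

theorem ProperOff.update [DecidableEq (Sym2 V)] (h : H.ProperOff c I)
    (hx : x ∉ I → H.MissesAt c x γ) (hy : y ∉ I → H.MissesAt c y γ)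
    (hH : ∀ a b, G.Adj a b → s(a, b) ≠ s(x, y) → H.Adj a b) :
    G.ProperOff (Function.update c s(x, y) γ) I := by
  intro v hv
  by_cases hvx : v = x
  · subst hvx; exact (h v hv).update (hx hv) hH
  by_cases hvy : v = y
  · subst hvy
    rw [Sym2.eq_swap]
    exact (h v hv).update (hy hv) (by rwa [Sym2.eq_swap (a := v)])
  have hne : ∀ a, s(v, a) ≠ s(x, y) := by
    intro a; simp [hvx, hvy]
  exact (h v hv).of_eq (fun a ha => hH _ _ ha (hne a))
    (fun a _ => Function.update_of_ne (hne a) _ _)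

theorem ncard_kempeGraph_neighborSet_le (h : G.ProperOff c I) (v : V) :
    ((G.kempeGraph c I α β).neighborSet v).ncard ≤ 2 := by
  by_cases hv : v ∈ I
  · have : (G.kempeGraph c I α β).neighborSet v = ∅ := by
      ext a; simp [kempeGraph, hv]
    simp [this]
  · refine (Set.ncard_le_ncard_of_injOn (t := {α, β}) (fun a => c s(v, a)) ?_ ?_
      (Set.toFinite _)).trans ((Set.ncard_insert_le _ _).trans (by simp))
    · rintro a ⟨-, -, -, ha⟩; simpa using ha
    · exact (h v hv).mono (fun a b hab => hab.1)

theorem ncard_kempeGraph_neighborSet_le_one (h : G.ProperOff c I) (hm : v ∉ I → G.MissesAt c v β) :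
    ((G.kempeGraph c I α β).neighborSet v).ncard ≤ 1 := by
  by_cases hv : v ∈ I
  · have : (G.kempeGraph c I α β).neighborSet v = ∅ := by
      ext a; simp [kempeGraph, hv]
    simp [this]
  · refine (Set.ncard_le_ncard_of_injOn (t := {α}) (fun a => c s(v, a)) ?_ ?_
      (Set.toFinite _)).trans (Set.ncard_singleton _).le
    · rintro a ⟨hadj, -, -, ha⟩
      simpa [hm hv a hadj] using ha
    · exact (h v hv).mono (fun a b hab => hab.1)

/-- A component of a graph of maximum degree at most two is a path or a cycle, so it does not
contain three vertices of degree at most one. This follows by counting edges: a connected graph on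
`n` vertices has at least `n - 1` edges. -/
theorem not_three_ends [Finite V] {L : SimpleGraph V} (h2 : ∀ v, (L.neighborSet v).ncard ≤ 2)
    {p q r : V} (hp : (L.neighborSet p).ncard ≤ 1) (hq : (L.neighborSet q).ncard ≤ 1)
    (hr : (L.neighborSet r).ncard ≤ 1) (hpq : p ≠ q) (hpr : p ≠ r) (hqr : q ≠ r)
    (hpq' : L.Reachable p q) (hpr' : L.Reachable p r) : False := by
  classical
  have := Fintype.ofFinite V
  set C := L.connectedComponentMk p with hC
  have hconn := C.connected_toSimpleGraph
  set L' := C.toSimpleGraph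
  have hE := hconn.card_vert_le_card_edgeSet_add_one
  have hsum := L'.sum_degrees_eq_twice_card_edges
  have hdeg : ∀ v : C, L'.degree v ≤ (L.neighborSet v.1).ncard := by
    intro v
    rw [← card_neighborSet_eq_degree, ← Nat.card_eq_fintype_card, Nat.card_coe_set_eq]
    refine Set.ncard_le_ncard_of_injOn Subtype.val ?_ Subtype.val_injective.injOn (Set.toFinite _)
    intro a ha
    exact ha
  let p' : C := ⟨p, rfl⟩
  let q' : C := ⟨q, ConnectedComponent.sound hpq'.symm⟩
  let r' : C := ⟨r, ConnectedComponent.sound hpr'.symm⟩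
  let T : Finset C := {p', q', r'}
  have hT : T.card = 3 := by
    apply Finset.card_eq_three.2
    exact ⟨p', q', r', fun h => hpq (congrArg Subtype.val h),
      fun h => hpr (congrArg Subtype.val h), fun h => hqr (congrArg Subtype.val h), rfl⟩
  have hle : ∑ v : C, (L'.degree v + if v ∈ T then 1 else 0) ≤ ∑ v : C, 2 := by
    refine Finset.sum_le_sum fun v _ => ?_
    split_ifs with hv
    · have hv1 : (L.neighborSet v.1).ncard ≤ 1 := by
        simp only [T, Finset.mem_insert, Finset.mem_singleton] at hv
        rcases hv with rfl | rfl | rfl <;> assumption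
      have := hdeg v
      omega
    · exact (hdeg v).trans (h2 _)
  rw [Finset.sum_add_distrib, hsum] at hle
  simp only [Finset.sum_ite_mem, Finset.univ_inter, Finset.sum_const, hT, Finset.card_univ,
    smul_eq_mul] at hle
  rw [Nat.card_eq_fintype_card, Nat.card_eq_fintype_card, ← edgeFinset_card] at hE
  omega

/-- Swapping `α` and `β` along the Kempe chain of `y`, which avoids `x`, makes `α` missing at both.
-/
theorem exists_kempe_swap (h : G.ProperOff c I) (hx : x ∉ I) (hy : y ∉ I)
    (hα : G.MissesAt c x α) (hβ : G.MissesAt c y β)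
    (hxy : ¬ (G.kempeGraph c I α β).Reachable y x) :
    ∃ c' : Sym2 V → K, G.ProperOff c' I ∧ G.MissesAt c' x α ∧ G.MissesAt c' y α := by
  classical
  let C : Set V := {v | (G.kempeGraph c I α β).Reachable y v}
  let c' : Sym2 V → K := fun e => if ∃ v ∈ e, v ∈ C then Equiv.swap α β (c e) else c e
  -- All edges at a vertex outside `I` are treated alike: edges of other colours are fixed by the
  -- swap, and an edge coloured `α` or `β` between vertices outside `I` lies in the chain with both
  -- endpoints or with none.
  have hC : ∀ v, v ∉ I → ∀ a, G.Adj v a →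
      c' s(v, a) = if v ∈ C then Equiv.swap α β (c s(v, a)) else c s(v, a) := by
    intro v hv a hva
    by_cases hvC : v ∈ C
    · rw [if_pos hvC]
      exact if_pos ⟨v, by simp, hvC⟩
    · rw [if_neg hvC]
      by_cases haC : a ∈ C
      · have haI : a ∉ I := by
          intro haI
          have haC' : (G.kempeGraph c I α β).Reachable y a := haC
          obtain ⟨w⟩ := haC'.symm
          cases w with
          | nil => exact hy haI
          | cons hadj _ => exact hadj.2.1 haI
        have hne : ¬ (c s(v, a) = α ∨ c s(v, a) = β) := fun hcol =>
          hvC (Reachable.trans haC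
            (Adj.reachable (⟨hva, hv, haI, hcol⟩ : (G.kempeGraph c I α β).Adj v a)).symm)
        push Not at hne
        simp only [c']
        rw [if_pos ⟨a, by simp, haC⟩, Equiv.swap_apply_of_ne_of_ne hne.1 hne.2]
      · refine if_neg ?_
        rintro ⟨b, hb, hbC⟩
        rcases Sym2.mem_iff.1 hb with rfl | rfl <;> contradiction
  refine ⟨c', ?_, ?_, ?_⟩
  · intro v hv a ha b hb hab
    have hab' : c' s(v, a) = c' s(v, b) := hab
    rw [hC v hv a ha, hC v hv b hb] at hab'
    split_ifs at hab' with hvC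
    · exact h v hv ha hb ((Equiv.swap α β).injective hab')
    · exact h v hv ha hb hab'
  · intro a ha
    rw [hC x hx a ha, if_neg (show x ∉ C from hxy)]
    exact hα a ha
  · intro a ha
    rw [hC y hy a ha, if_pos (show y ∈ C from Reachable.refl y)]
    intro hab
    rw [Equiv.swap_apply_eq_iff, Equiv.swap_apply_left] at hab
    exact hβ a ha hab

/-- If `z` is the only neighbour of `x` in `L`, then a path from `u` to `x` reaches `z` before
using `x`. -/
theorem Reachable.of_unique_neighbor {L M : SimpleGraph V} (h : L.Reachable u x) (hux : u ≠ x)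
    (hz : ∀ a, L.Adj x a → a = z) (hM : ∀ a b, a ≠ x → b ≠ x → L.Adj a b → M.Adj a b) :
    M.Reachable u z := by
  rw [reachable_iff_reflTransGen] at h
  have key : ∀ y, Relation.ReflTransGen L.Adj u y →
      (y ≠ x → M.Reachable u y) ∧ (y = x → M.Reachable u z) := by
    intro y hy
    induction hy with
    | refl => exact ⟨fun _ => Reachable.refl u, fun h => absurd h hux⟩
    | @tail b d _ hbd ih =>
      refine ⟨fun hd => ?_, fun hd => ?_⟩
      · by_cases hb : b = x
        · subst hb
          rw [hz d hbd]
          exact ih.2 rfl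
        · exact (ih.1 hb).trans (Adj.reachable (hM b d hb hd hbd))
      · subst hd
        rw [← hz b hbd.symm]
        exact ih.1 hbd.ne
  exact (key x h).2 rfl

/-! ### Vizing's theorem with unconstrained vertices -/

theorem ProperOff.mono (h : G.ProperOff c I) (hle : H ≤ G) : H.ProperOff c I :=
  fun v hv => (h v hv).mono hle

/-- If a colouring of `G` minus the edge `xu` cannot be turned into one of `G`, then every Kempe
chain that starts at `u` with a colour missing at `u`, for a second colour missing at `x`, ends at
`x`. -/
theorem reachable_of_not_exists_properOff (hG : ¬ ∃ c : Sym2 V → K, G.ProperOff c I)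
    (hc : (G.deleteEdges {s(x, u)}).ProperOff c I) (hx : x ∉ I)
    (hα : (G.deleteEdges {s(x, u)}).MissesAt c x α)
    (hβ : u ∉ I → (G.deleteEdges {s(x, u)}).MissesAt c u β) :
    u ∉ I ∧ ¬ (G.deleteEdges {s(x, u)}).MissesAt c x β ∧
      ((G.deleteEdges {s(x, u)}).kempeGraph c I α β).Reachable u x := by
  classical
  have hH : ∀ a b, G.Adj a b → s(a, b) ≠ s(x, u) → (G.deleteEdges {s(x, u)}).Adj a b :=
    fun a b hab hne => deleteEdges_adj.2 ⟨hab, hne⟩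
  have hu : u ∉ I := fun hu => hG ⟨_, hc.update (fun _ => hα) (fun h => absurd hu h) hH⟩
  refine ⟨hu, fun hm => hG ⟨_, hc.update (fun _ => hm) hβ hH⟩, ?_⟩
  by_contra hr
  obtain ⟨c', hc', hx', hu'⟩ := exists_kempe_swap hc hx hu hα (hβ hu) hr
  exact hG ⟨_, hc'.update (fun _ => hx') (fun _ => hu') hH⟩

/-- The outcome of moving the uncoloured edge around `x`: the colouring `c` of `G` minus `xy` has
become the colouring `c'` of `G` minus `xu`, where each edge `xp` with `p ∈ A` has received the
colour `f p`, which `c` misses at `p`, and nothing else has changed. The field `linked` records,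
for each `p ∈ A`, the edge `xq` from which its new colour was taken and the Kempe chain from `p` to
`q` that avoids `x`; as it uses no edge at `x`, that chain is the same for `c` and `c'`. -/
structure IsFanShift (G : SimpleGraph V) (c : Sym2 V → K) (I : Set V) (f : V → K) (x y : V) (α : K)
    (A : Finset V) (u : V) (c' : Sym2 V → K) : Prop where
  adj : G.Adj x u
  proper : (G.deleteEdges {s(x, u)}).ProperOff c' I
  eq_off : ∀ e, x ∉ e → c' e = c e
  eq_old : ∀ z, z ∉ A → z ≠ u → c' s(x, z) = c s(x, z)
  eq_new : ∀ p ∈ A, c' s(x, p) = f p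
  misses : (G.deleteEdges {s(x, u)}).MissesAt c' x α
  notMem : u ∉ A
  start : y ∈ A ∨ u = y
  linked : ∀ p ∈ A, p ∉ I ∧ ∃ q, (G.deleteEdges {s(x, y)}).Adj x q ∧ c s(x, q) = f p ∧
    ((G.deleteIncidenceSet x).kempeGraph c I α (f p)).Reachable p q

/-- The uncoloured edge `xu` takes the colour `f u` of another edge `xz`, which becomes uncoloured.
The point is that `z` is new: if `z ∈ A`, then `f z = f u`, and `z`, `u` and the vertex `q` linked
to `z` would be three ends of one Kempe chain avoiding `x`. -/
theorem IsFanShift.exists_next [Finite V] [DecidableEq V] {f : V → K} {A : Finset V}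
    (hG : ¬ ∃ c : Sym2 V → K, G.ProperOff c I) (hx : x ∉ I)
    (hc : (G.deleteEdges {s(x, y)}).ProperOff c I)
    (hf : ∀ z, z ∉ I → (G.deleteEdges {s(x, y)}).MissesAt c z (f z))
    (h : G.IsFanShift c I f x y α A u c') :
    ∃ z c'', G.IsFanShift c I f x y α (insert u A) z c'' := by
  have hxu : u ≠ x := h.adj.ne'
  have hmu : u ∉ I → (G.deleteEdges {s(x, u)}).MissesAt c' u (f u) := by
    intro hu a ha
    rw [deleteEdges_adj, Set.mem_singleton_iff] at ha
    have hax : a ≠ x := by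
      rintro rfl
      exact ha.2 Sym2.eq_swap
    have hxe : x ∉ s(u, a) := by simp [hxu.symm, hax.symm]
    rw [h.eq_off _ hxe]
    refine hf u hu a (deleteEdges_adj.2 ⟨ha.1, ?_⟩)
    rintro (heq : s(u, a) = s(x, y))
    exact hxe (heq ▸ Sym2.mem_mk_left x y)
  obtain ⟨hu, hβ, hreach⟩ := reachable_of_not_exists_properOff hG h.proper hx h.misses hmu
  simp only [MissesAt, not_forall, not_not] at hβ
  obtain ⟨z, hz, hzβ⟩ := hβ
  have hzu : z ≠ u := by
    rintro rfl
    exact (deleteEdges_adj.1 hz).2 rfl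
  have hOH : G.deleteIncidenceSet x ≤ G.deleteEdges {s(x, y)} := by
    intro a b hab
    rw [deleteIncidenceSet_adj] at hab
    refine deleteEdges_adj.2 ⟨hab.1, ?_⟩
    simp [hab.2.1, hab.2.2]
  have hlink : ((G.deleteIncidenceSet x).kempeGraph c I α (f u)).Reachable u z := by
    refine hreach.of_unique_neighbor hxu ?_ ?_
    · rintro a ⟨ha, -, -, hcol | hcol⟩
      · exact absurd hcol (h.misses a ha)
      · exact h.proper x hx ha hz (hcol.trans hzβ.symm)
    · rintro a b ha hb ⟨hab, haI, hbI, hcol⟩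
      rw [h.eq_off _ (by simp [ha.symm, hb.symm])] at hcol
      exact ⟨deleteIncidenceSet_adj.2 ⟨(deleteEdges_adj.1 hab).1, ha, hb⟩, haI, hbI, hcol⟩
  -- The vertices `z`, `q`, `u` each miss the colour `f u` away from `x`: `z` and `u` by the choice
  -- of `f`, and `q` because its only edge of this colour is `xq`.
  have hzA : z ∉ A := by
    intro hzA
    have hfz : f z = f u := (h.eq_new z hzA).symm.trans hzβ
    obtain ⟨hzI, q, hq, hqc, hzq⟩ := h.linked z hzA
    rw [hfz] at hqc hzq
    have hO := hc.mono hOH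
    refine not_three_ends (fun v => ncard_kempeGraph_neighborSet_le hO v)
      (ncard_kempeGraph_neighborSet_le_one hO fun _ => (hfz ▸ hf z hzI).mono hOH)
      (ncard_kempeGraph_neighborSet_le_one (v := q) hO fun hqI a ha hac => ?_)
      (ncard_kempeGraph_neighborSet_le_one hO fun _ => (hf u hu).mono hOH)
      ?_ hzu ?_ hzq hlink.symm
    · refine (deleteIncidenceSet_adj.1 ha).2.2 (hc q hqI (hOH ha) hq.symm ?_)
      change c s(q, a) = c s(q, x)
      rw [hac, ← hqc, Sym2.eq_swap]
    · rintro rfl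
      refine hf z hzI x hq.symm ?_
      rw [Sym2.eq_swap, hqc, hfz]
    · rintro rfl
      refine hf q hu x hq.symm ?_
      rw [Sym2.eq_swap, hqc]
  refine ⟨z, Function.update c' s(x, u) (f u), (deleteEdges_adj.1 hz).1, ?_, ?_, ?_, ?_, ?_, ?_,
    ?_, ?_⟩
  · have hle : (G.deleteEdges {s(x, z)}).deleteEdges {s(x, u)} ≤ G.deleteEdges {s(x, u)} :=
      deleteEdges_mono (deleteEdges_le _)
    refine (h.proper.mono hle).update (fun _ a ha hac => ?_) (fun hu => (hmu hu).mono hle)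
      (fun a b hab hne => deleteEdges_adj.2 ⟨hab, hne⟩)
    have haz : a = z := h.proper x hx (hle ha) hz (hac.trans hzβ.symm)
    exact (deleteEdges_adj.1 (deleteEdges_adj.1 ha).1).2 (by rw [haz]; rfl)
  · intro e he
    rw [Function.update_of_ne, h.eq_off e he]
    rintro rfl
    exact he (Sym2.mem_mk_left x u)
  · intro w hw _
    rw [Finset.mem_insert, not_or] at hw
    rw [Function.update_of_ne (mt Sym2.congr_right.1 hw.1), h.eq_old w hw.2 hw.1]
  · intro p hp
    by_cases hpu : p = u
    · rw [hpu, Function.update_self]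
    · rw [Function.update_of_ne (mt Sym2.congr_right.1 hpu),
        h.eq_new p (Finset.mem_of_mem_insert_of_ne hp hpu)]
  · intro a ha
    by_cases hau : a = u
    · rw [hau, Function.update_self, ← hzβ]
      exact h.misses z hz
    · have hne : s(x, a) ≠ s(x, u) := mt Sym2.congr_right.1 hau
      rw [Function.update_of_ne hne]
      exact h.misses a (deleteEdges_adj.2 ⟨(deleteEdges_adj.1 ha).1, hne⟩)
  · simp [hzu, hzA]
  · rcases h.start with hy | rfl
    · exact Or.inl (Finset.mem_insert_of_mem hy)
    · exact Or.inl (Finset.mem_insert_self _ _)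
  · intro p hp
    rcases Finset.mem_insert.1 hp with rfl | hp
    · refine ⟨hu, z, deleteEdges_adj.2 ⟨(deleteEdges_adj.1 hz).1, ?_⟩, ?_, hlink⟩
      · refine mt Sym2.congr_right.1 ?_
        rcases h.start with hy | rfl
        · rintro rfl
          exact hzA hy
        · exact hzu
      · rw [← h.eq_old z hzA hzu, hzβ]
    · exact h.linked p hp

/-- Otherwise the uncoloured edge could be shifted around `x` forever, each time using up a vertex.
-/
theorem ProperOff.exists_of_deleteEdges [Finite V] [Fintype K] [Nonempty K]
    (hdeg : ∀ v, v ∉ I → (G.neighborSet v).ncard < Fintype.card K) (hx : x ∉ I)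
    (hxy : G.Adj x y) (hc : (G.deleteEdges {s(x, y)}).ProperOff c I) :
    ∃ c' : Sym2 V → K, G.ProperOff c' I := by
  classical
  have := Fintype.ofFinite V
  by_contra hG
  have hmiss : ∀ z, ∃ γ, z ∉ I → (G.deleteEdges {s(x, y)}).MissesAt c z γ := by
    intro z
    by_cases hz : z ∈ I
    · exact ⟨Classical.arbitrary K, fun h => absurd hz h⟩
    · obtain ⟨γ, hγ⟩ := exists_missesAt (G.deleteEdges {s(x, y)}) c z
        ((Set.ncard_le_ncard (fun a ha => (deleteEdges_adj.1 ha).1) (Set.toFinite _)).trans_lt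
          (hdeg z hz))
      exact ⟨γ, fun _ => hγ⟩
  choose f hf using hmiss
  have key : ∀ n, ∃ A u c', A.card = n ∧ G.IsFanShift c I f x y (f x) A u c' := by
    intro n
    induction n with
    | zero =>
      exact ⟨∅, y, c, rfl, hxy, hc, fun _ _ => rfl, fun _ _ _ => rfl, by simp, hf x hx, by simp,
        Or.inr rfl, by simp⟩
    | succ n ih =>
      obtain ⟨A, u, c', hA, h⟩ := ih
      obtain ⟨z, c'', h'⟩ := h.exists_next hG hx hc hf
      exact ⟨_, z, c'', by rw [Finset.card_insert_of_notMem h.notMem, hA], h'⟩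
  obtain ⟨A, -, -, hA, -⟩ := key (Fintype.card V + 1)
  have := A.card_le_univ
  omega

/-- Vizing's theorem, with an independent set `I` of vertices at which nothing is required: if all
other degrees are less than the number of colours, some colouring is proper outside `I`. -/
theorem exists_properOff [Finite V] [Fintype K] [Nonempty K] (G : SimpleGraph V)
    (hI : ∀ a ∈ I, ∀ b ∈ I, ¬ G.Adj a b)
    (hdeg : ∀ v, v ∉ I → (G.neighborSet v).ncard < Fintype.card K) :
    ∃ c : Sym2 V → K, G.ProperOff c I := by
  induction hn : G.edgeSet.ncard using Nat.strong_induction_on generalizing G with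
  | _ n ih =>
    subst hn
    by_cases hE : ∃ x y, G.Adj x y
    · obtain ⟨x, y, hxy⟩ : ∃ x y, G.Adj x y ∧ x ∉ I := by
        obtain ⟨x, y, hxy⟩ := hE
        by_cases hx : x ∈ I
        · exact ⟨y, x, hxy.symm, fun hy => hI x hx y hy hxy⟩
        · exact ⟨x, y, hxy, hx⟩
      have hle : G.deleteEdges {s(x, y)} ≤ G := deleteEdges_le _
      obtain ⟨c, hc⟩ := ih _ (Set.ncard_lt_ncard (s := (G.deleteEdges {s(x, y)}).edgeSet)
        ⟨edgeSet_mono hle, fun h => by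
          have := h (show s(x, y) ∈ G.edgeSet from hxy.1)
          simp at this⟩ (Set.toFinite _)) (G.deleteEdges {s(x, y)})
        (fun a ha b hb hab => hI a ha b hb (hle hab))
        (fun v hv => (Set.ncard_le_ncard (fun a ha => hle ha) (Set.toFinite _)).trans_lt
          (hdeg v hv)) rfl
      exact hc.exists_of_deleteEdges hdeg hxy.2 hxy.1
    · push Not at hE
      exact ⟨fun _ => Classical.arbitrary K, fun v _ a ha => absurd ha (hE v a)⟩

/-! ### Edge boundaries and ears -/

/-- The edge boundary of `S`: the edges of `G` with exactly one endpoint in `S`. -/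
def edgeCut (G : SimpleGraph V) (S : Set V) : Set (Sym2 V) :=
  {e | ∃ a ∈ S, ∃ b ∉ S, G.Adj a b ∧ e = s(a, b)}

/-- Some edge boundary whose edges have distinct colours separates `u` from `v`. -/
def RainbowSeparates (G : SimpleGraph V) (c : Sym2 V → K) (u v : V) : Prop :=
  ∃ S : Set V, Set.InjOn c (G.edgeCut S) ∧ u ∈ S ∧ v ∉ S

theorem edgeCut_compl (G : SimpleGraph V) (S : Set V) : G.edgeCut Sᶜ = G.edgeCut S := by
  ext e
  constructor <;> rintro ⟨a, ha, b, hb, hab, rfl⟩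
  · exact ⟨b, by simpa using hb, a, ha, hab.symm, Sym2.eq_swap⟩
  · exact ⟨b, hb, a, by simpa using ha, hab.symm, Sym2.eq_swap⟩

theorem edgeCut_mono (hle : H ≤ G) (S : Set V) : H.edgeCut S ⊆ G.edgeCut S := by
  rintro e ⟨a, ha, b, hb, hab, rfl⟩
  exact ⟨a, ha, b, hb, hle hab, rfl⟩

theorem RainbowSeparates.symm (h : G.RainbowSeparates c u v) : G.RainbowSeparates c v u := by
  obtain ⟨S, hS, hu, hv⟩ := h
  exact ⟨Sᶜ, by rwa [edgeCut_compl], hv, by simpa using hu⟩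

theorem RainbowAt.rainbowSeparates (h : G.RainbowAt c u) (huv : u ≠ v) :
    G.RainbowSeparates c u v := by
  refine ⟨{u}, ?_, rfl, huv.symm⟩
  rintro _ ⟨a, rfl, b, -, hab, rfl⟩ _ ⟨a', rfl, b', -, hab', rfl⟩ heq
  rw [h hab hab' heq]

theorem injOn_of_subset_edgeCut {S S' : Set V} (hS : Set.InjOn c (H.edgeCut S))
    (h : ∀ x ∈ S', ∀ y ∉ S', G.Adj x y → x ∈ S ∧ y ∉ S ∧ H.Adj x y ∧ c' s(x, y) = c s(x, y)) :
    Set.InjOn c' (G.edgeCut S') := by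
  rintro _ ⟨x, hx, y, hy, hxy, rfl⟩ _ ⟨x', hx', y', hy', hxy', rfl⟩ heq
  obtain ⟨h1, h2, h3, h4⟩ := h x hx y hy hxy
  obtain ⟨h1', h2', h3', h4'⟩ := h x' hx' y' hy' hxy'
  exact hS ⟨x, h1, y, h2, h3, rfl⟩ ⟨x', h1', y', h2', h3', rfl⟩ (h4.symm.trans (heq.trans h4'))

/-- If the vertices of `T` have no neighbour outside `T` except `w`, then adding the edges at `T`
does not affect the separation of other vertices, since `T` can be put on the side of `w`. -/
theorem RainbowSeparates.extend {T : Set V} (h : H.RainbowSeparates c u v)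
    (hT : ∀ t ∈ T, ∀ y, G.Adj t y → y ∈ T ∨ y = w)
    (hH : ∀ x ∉ T, ∀ y ∉ T, G.Adj x y → H.Adj x y ∧ c' s(x, y) = c s(x, y))
    (hu : u ∉ T) (hv : v ∉ T) : G.RainbowSeparates c' u v := by
  obtain ⟨S, hS, huS, hvS⟩ := h
  by_cases hw : w ∈ S
  · refine ⟨S ∪ T, injOn_of_subset_edgeCut hS ?_, Or.inl huS, fun h => h.elim hvS hv⟩
    intro x hx y hy hxy
    rw [Set.mem_union, not_or] at hy
    have hxT : x ∉ T := fun hxT => (hT x hxT y hxy).elim hy.2 fun hyw => hy.1 (hyw ▸ hw)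
    exact ⟨hx.resolve_right hxT, hy.1, hH x hxT y hy.2 hxy⟩
  · refine ⟨S \ T, injOn_of_subset_edgeCut hS ?_, ⟨huS, hu⟩, fun h => hvS h.1⟩
    intro x hx y hy hxy
    have hyT : y ∉ T := fun hyT => (hT y hyT x hxy.symm).elim hx.2 fun hxw => hw (hxw ▸ hx.1)
    exact ⟨hx.1, fun hyS => hy ⟨hyS, hyT⟩, hH x hx.2 y hyT hxy⟩

theorem injOn_insert_star {e : Sym2 V} (hw : H.RainbowAt c w) (hm : H.MissesAt c w γ)
    (hc : ∀ y, H.Adj w y → c' s(w, y) = c s(w, y)) (he : c' e = γ) :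
    Set.InjOn c' (insert e ((fun y => s(w, y)) '' H.neighborSet w)) := by
  rintro _ (rfl | ⟨y, hy, rfl⟩) _ (rfl | ⟨y', hy', rfl⟩) heq
  · rfl
  · exact absurd (((hc y' hy').symm.trans heq.symm).trans he) (hm y' hy')
  · exact absurd (((hc y hy).symm.trans heq).trans he) (hm y hy)
  · have : y = y' := hw hy hy' (((hc y hy).symm.trans heq).trans (hc y' hy'))
    rw [this]

theorem exists_notMem_finset (s : Finset (Fin (k + 1))) (h : s.card ≤ k) : ∃ γ, γ ∉ s := by
  by_contra! hs
  have := Finset.card_le_card (fun γ _ => hs γ : Finset.univ ⊆ s)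
  simp at this
  omega

theorem rainbowAt_of_neighborSet_pair (h : G.neighborSet v = {x, y})
    (hxy : c s(v, x) ≠ c s(v, y)) : G.RainbowAt c v := by
  rw [RainbowAt, h]
  rintro p (rfl | rfl) q (rfl | rfl) heq
  · rfl
  · exact absurd heq hxy
  · exact absurd heq.symm hxy
  · rfl

theorem rainbowAt_of_neighborSet_triple (h : G.neighborSet v = {x, y, z})
    (hxy : c s(v, x) ≠ c s(v, y)) (hxz : c s(v, x) ≠ c s(v, z)) (hyz : c s(v, y) ≠ c s(v, z)) :
    G.RainbowAt c v := by
  rw [RainbowAt, h]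
  rintro p (rfl | rfl | rfl) q (rfl | rfl | rfl) heq
  · rfl
  · exact absurd heq hxy
  · exact absurd heq hxz
  · exact absurd heq.symm hxy
  · rfl
  · exact absurd heq hyz
  · exact absurd heq.symm hxz
  · exact absurd heq.symm hyz
  · rfl

/-- A triangle `w, a, b` attached to the rest of `G` at its apex `w` and by one further edge `bz`:
the vertex `a` has degree two and `b` has degree three. -/
structure IsEar (G : SimpleGraph V) (w a b z : V) : Prop where
  left : G.neighborSet a = {w, b}
  right : G.neighborSet b = {w, a, z}
  ne_apex : z ≠ w
  ne_left : z ≠ a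

theorem IsEar.adj_apex_left (h : G.IsEar w a b z) : G.Adj w a :=
  SimpleGraph.Adj.symm (show w ∈ G.neighborSet a by simp [h.left])

theorem IsEar.adj_left_right (h : G.IsEar w a b z) : G.Adj a b :=
  show b ∈ G.neighborSet a by simp [h.left]

theorem IsEar.adj_apex_right (h : G.IsEar w a b z) : G.Adj w b :=
  SimpleGraph.Adj.symm (show w ∈ G.neighborSet b by simp [h.right])

theorem IsEar.adj_right (h : G.IsEar w a b z) : G.Adj b z :=
  show z ∈ G.neighborSet b by simp [h.right]

theorem IsEar.eq_or_eq_of_adj_left (h : G.IsEar w a b z) (ha : G.Adj a y) : y = w ∨ y = b := by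
  have : y ∈ G.neighborSet a := ha
  simpa [h.left] using this

theorem IsEar.eq_or_eq_of_adj_right (h : G.IsEar w a b z) (hb : G.Adj b y) :
    y = w ∨ y = a ∨ y = z := by
  have : y ∈ G.neighborSet b := hb
  simpa [h.right] using this

theorem exists_recolor_left [DecidableEq (Sym2 V)] (c : Sym2 V → K) (δ ε : K) (hwb : w ≠ b) :
    ∃ c' : Sym2 V → K, (∀ e, a ∉ e → c' e = c e) ∧ c' s(a, b) = δ ∧ c' s(a, w) = ε := by
  refine ⟨Function.update (Function.update c s(a, w) ε) s(a, b) δ, ?_, ?_, ?_⟩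
  · intro e he
    rw [Function.update_of_ne, Function.update_of_ne] <;>
    · rintro rfl
      exact he (Sym2.mem_mk_left _ _)
  · exact Function.update_self ..
  · rw [Function.update_of_ne (mt Sym2.congr_right.1 hwb), Function.update_self]

/-- A colouring of `G - a` with rainbow stars at `w` and `b` extends to `a` so that the stars of
`a` and `b` and the boundary of `{w, a}` or of `{w, a, b}` are rainbow. -/
theorem IsEar.exists_extension [Finite V] {c : Sym2 V → Fin (k + 1)} (h : G.IsEar w a b z)
    (hk : 2 ≤ k) (hdeg : (G.neighborSet w).ncard ≤ k + 1)
    (hw : (G.deleteIncidenceSet a).RainbowAt c w) (hb : (G.deleteIncidenceSet a).RainbowAt c b) :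
    ∃ c' : Sym2 V → Fin (k + 1), (∀ e, a ∉ e → c' e = c e) ∧ G.RainbowAt c' a ∧ G.RainbowAt c' b ∧
      ∃ S ⊆ {w, a, b}, w ∈ S ∧ Set.InjOn c' (G.edgeCut S) := by
  classical
  have hwa := h.adj_apex_left.ne
  have hab := h.adj_left_right.ne
  have hwb := h.adj_apex_right.ne
  have hbz := h.adj_right.ne
  have hHwb : (G.deleteIncidenceSet a).Adj b w :=
    deleteIncidenceSet_adj.2 ⟨h.adj_apex_right.symm, hab.symm, hwa⟩
  have hHbz : (G.deleteIncidenceSet a).Adj b z :=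
    deleteIncidenceSet_adj.2 ⟨h.adj_right, hab.symm, h.ne_left⟩
  have hbw_bz : c s(b, w) ≠ c s(b, z) := fun heq => h.ne_apex (hb hHwb hHbz heq).symm
  have hdegH : ((G.deleteIncidenceSet a).neighborSet w).ncard < Fintype.card (Fin (k + 1)) := by
    rw [Fintype.card_fin]
    refine (Set.ncard_lt_ncard (t := G.neighborSet w) ⟨?_, fun hsub => ?_⟩
      (Set.toFinite _)).trans_le hdeg
    · exact fun y hy => (deleteIncidenceSet_adj.1 hy).1
    · exact (deleteIncidenceSet_adj.1 (hsub h.adj_apex_left)).2.2 rfl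
  obtain ⟨γ, hγ⟩ := exists_missesAt _ c w hdegH
  have hadjw : ∀ y, G.Adj w y → y ≠ a → (G.deleteIncidenceSet a).Adj w y :=
    fun y hy hya => deleteIncidenceSet_adj.2 ⟨hy, hwa, hya⟩
  have hnot : ∀ {p q : V}, p ≠ a → q ≠ a → a ∉ s(p, q) := by
    intro p q hp hq
    simp [hp.symm, hq.symm]
  -- The star of `w` in `G - a` together with one edge coloured `γ` is rainbow. That edge is `bz`
  -- if it has the colour `γ`, with `b` on the side of `w`; otherwise it can be `ab`.
  by_cases hcz : c s(b, z) = γ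
  · obtain ⟨δ, hδ⟩ := exists_notMem_finset {c s(b, w), c s(b, z)}
      (Finset.card_le_two.trans hk)
    obtain ⟨ε, hε⟩ := exists_notMem_finset {δ} (by simp; omega)
    simp only [Finset.mem_insert, Finset.mem_singleton, not_or] at hδ hε
    obtain ⟨c', hc', hc'b, hc'w⟩ := exists_recolor_left (a := a) c δ ε hwb
    have hbw' := hc' s(b, w) (hnot hab.symm hwa)
    have hbz' := hc' s(b, z) (hnot hab.symm h.ne_left)
    have hba' : c' s(b, a) = δ := by rw [Sym2.eq_swap, hc'b]
    refine ⟨c', hc', rainbowAt_of_neighborSet_pair h.left (by rwa [hc'b, hc'w]),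
      rainbowAt_of_neighborSet_triple h.right (by rw [hbw', hba']; exact Ne.symm hδ.1)
        (by rwa [hbw', hbz']) (by rw [hba', hbz']; exact hδ.2), {w, a, b}, subset_rfl, by simp, ?_⟩
    refine (injOn_insert_star hw hγ (fun y hy => hc' _ (hnot hwa (deleteIncidenceSet_adj.1 hy).2.2))
      (hbz'.trans hcz)).mono ?_
    rintro _ ⟨p, hp, q, hq, hpq, rfl⟩
    simp only [Set.mem_insert_iff, Set.mem_singleton_iff, not_or] at hp hq
    rcases hp with rfl | rfl | rfl
    · exact Or.inr ⟨q, hadjw q hpq hq.2.1, rfl⟩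
    · rcases h.eq_or_eq_of_adj_left hpq with rfl | rfl <;> simp at hq
    · rcases h.eq_or_eq_of_adj_right hpq with rfl | rfl | rfl
      · simp at hq
      · simp at hq
      · exact Or.inl rfl
  · obtain ⟨ε, hε⟩ := exists_notMem_finset {γ} (by simp; omega)
    rw [Finset.mem_singleton] at hε
    obtain ⟨c', hc', hc'b, hc'w⟩ := exists_recolor_left (a := a) c γ ε hwb
    have hbw' := hc' s(b, w) (hnot hab.symm hwa)
    have hbz' := hc' s(b, z) (hnot hab.symm h.ne_left)
    have hba' : c' s(b, a) = γ := by rw [Sym2.eq_swap, hc'b]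
    have hbw_ne : c s(b, w) ≠ γ := by
      rw [Sym2.eq_swap]
      exact hγ b hHwb.symm
    refine ⟨c', hc', rainbowAt_of_neighborSet_pair h.left (by rwa [hc'b, hc'w]),
      rainbowAt_of_neighborSet_triple h.right (by rwa [hbw', hba'])
        (by rwa [hbw', hbz']) (by rw [hba', hbz']; exact Ne.symm hcz), {w, a}, ?_, by simp, ?_⟩
    · rintro p (rfl | rfl) <;> simp
    refine (injOn_insert_star hw hγ (fun y hy => hc' _ (hnot hwa (deleteIncidenceSet_adj.1 hy).2.2))
      hc'b).mono ?_
    rintro _ ⟨p, hp, q, hq, hpq, rfl⟩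
    simp only [Set.mem_insert_iff, Set.mem_singleton_iff, not_or] at hp hq
    rcases hp with rfl | rfl
    · exact Or.inr ⟨q, hadjw q hpq hq.2, rfl⟩
    · rcases h.eq_or_eq_of_adj_left hpq with rfl | rfl
      · simp at hq
      · exact Or.inl rfl

/-- The degree sum over `X` counts each boundary edge once and each edge inside `X` twice. -/
theorem sum_ncard_neighborSet_le [Fintype V] [DecidableRel G.Adj] (X : Finset V) :
    ∑ x ∈ X, (G.neighborSet x).ncard ≤
      (G.edgeCut X).ncard + ∑ x ∈ X, ∑ y ∈ X, if G.Adj x y then 1 else 0 := by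
  classical
  have hsplit : ∀ x, (G.neighborSet x).ncard =
      (G.neighborFinset x \ X).card + ∑ y ∈ X, if G.Adj x y then 1 else 0 := by
    intro x
    rw [← Finset.card_filter, Set.ncard_eq_toFinset_card', ← neighborFinset_def,
      ← Finset.card_sdiff_add_card_inter _ X]
    congr 2
    ext y
    simp [and_comm]
  rw [Finset.sum_congr rfl fun x _ => hsplit x, Finset.sum_add_distrib]
  gcongr
  rw [← Finset.card_sigma, ← Set.ncard_coe_finset]
  refine Set.ncard_le_ncard_of_injOn (fun p => s(p.1, p.2)) ?_ ?_ (Set.toFinite _)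
  · rintro ⟨x, y⟩ hp
    simp only [Finset.coe_sigma, Set.mem_sigma_iff, Finset.mem_coe, Finset.mem_sdiff,
      mem_neighborFinset] at hp
    exact ⟨x, hp.1, y, hp.2.2, hp.2.1, rfl⟩
  · rintro ⟨x, y⟩ hp ⟨x', y'⟩ hp' heq
    simp only [Finset.coe_sigma, Set.mem_sigma_iff, Finset.mem_coe, Finset.mem_sdiff,
      mem_neighborFinset] at hp hp'
    rcases Sym2.eq_iff.1 heq with ⟨rfl, rfl⟩ | ⟨rfl, rfl⟩
    · rfl
    · exact absurd hp.1 hp'.2.2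

theorem neighborSet_eq_pair [Finite V] (hx : G.Adj v x) (hy : G.Adj v y) (hxy : x ≠ y)
    (h : (G.neighborSet v).ncard = 2) : G.neighborSet v = {x, y} := by
  symm
  refine Set.eq_of_subset_of_ncard_le ?_ (by rw [h, Set.ncard_pair hxy]) (Set.toFinite _)
  rintro p (rfl | rfl) <;> assumption

theorem exists_neighborSet_eq_triple [Finite V] (hx : G.Adj v x) (hy : G.Adj v y) (hxy : x ≠ y)
    (h : (G.neighborSet v).ncard = 3) : ∃ z, z ≠ x ∧ z ≠ y ∧ G.neighborSet v = {x, y, z} := by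
  have hlt : ({x, y} : Set V).ncard < (G.neighborSet v).ncard := by
    rw [h, Set.ncard_pair hxy]; norm_num
  obtain ⟨z, hz, hzxy⟩ := Set.exists_mem_notMem_of_ncard_lt_ncard hlt (Set.toFinite _)
  simp only [Set.mem_insert_iff, Set.mem_singleton_iff, not_or] at hzxy
  refine ⟨z, hzxy.1, hzxy.2, ?_⟩
  symm
  refine Set.eq_of_subset_of_ncard_le ?_ ?_ (Set.toFinite _)
  · rintro p (rfl | rfl | rfl) <;> assumption
  · rw [h, Set.ncard_eq_three.2 ⟨x, y, z, hxy, Ne.symm hzxy.1, Ne.symm hzxy.2, rfl⟩]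

/-- A set of at most three vertices with at most `k` boundary edges, one of which has degree above
`k`, is a triangle whose two other vertices have degrees `2, 2` or `2, 3`, provided that no vertex
has degree one. In the second case the large vertex has degree exactly `k + 1`. -/
theorem exists_triangle_of_edgeCut_le [Fintype V] {X : Finset V} (hX : X.card ≤ 3) (hwX : w ∈ X)
    (hw : k < (G.neighborSet w).ncard) (hcut : (G.edgeCut X).ncard ≤ k)
    (hpend : ∀ v, (G.neighborSet v).ncard ≠ 1) :
    ∃ a b, (G.neighborSet a = {w, b} ∧ G.neighborSet b = {w, a}) ∨
      ((G.neighborSet w).ncard = k + 1 ∧ ∃ z, G.IsEar w a b z) := by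
  classical
  have hsum := (sum_ncard_neighborSet_le (G := G) X).trans (Nat.add_le_add_right hcut _)
  obtain ⟨Y, hwY, rfl⟩ : ∃ Y, w ∉ Y ∧ X = insert w Y :=
    ⟨X.erase w, Finset.notMem_erase w X, (Finset.insert_erase hwX).symm⟩
  rw [Finset.card_insert_of_notMem hwY] at hX
  obtain h0 | h1 | h2 : Y.card = 0 ∨ Y.card = 1 ∨ Y.card = 2 := by omega
  · rw [Finset.card_eq_zero] at h0
    subst h0
    simp only [insert_empty_eq, Finset.sum_singleton, SimpleGraph.irrefl, if_false] at hsum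
    omega
  · obtain ⟨a, rfl⟩ := Finset.card_eq_one.1 h1
    rw [Finset.mem_singleton] at hwY
    have := hpend a
    simp only [Finset.sum_insert (show w ∉ ({a} : Finset V) by simpa using hwY),
      Finset.sum_singleton, SimpleGraph.irrefl, if_false, G.adj_comm a w] at hsum
    have ha0 : G.Adj w a → (G.neighborSet a).ncard ≠ 0 := by
      intro hwa h0
      rw [Set.ncard_eq_zero] at h0
      exact (h0 ▸ (show w ∈ G.neighborSet a from hwa.symm) : w ∈ (∅ : Set V))
    split_ifs at hsum with hwa
    · have := ha0 hwa; omega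
    · omega
  · obtain ⟨a, b, hab, rfl⟩ := Finset.card_eq_two.1 h2
    simp only [Finset.mem_insert, Finset.mem_singleton, not_or] at hwY
    have ha1 := hpend a
    have hb1 := hpend b
    simp only [Finset.sum_insert (show w ∉ ({a, b} : Finset V) by simpa using hwY),
      Finset.sum_insert (show a ∉ ({b} : Finset V) by simpa using hab),
      Finset.sum_singleton, SimpleGraph.irrefl, if_false, G.adj_comm a w, G.adj_comm b w,
      G.adj_comm b a] at hsum
    have hne : ∀ {x y}, G.Adj x y → (G.neighborSet x).ncard ≠ 0 := by
      intro x y hxy h0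
      rw [Set.ncard_eq_zero] at h0
      exact (h0 ▸ (show y ∈ G.neighborSet x from hxy) : y ∈ (∅ : Set V))
    have hall : G.Adj w a ∧ G.Adj w b ∧ G.Adj a b := by
      by_cases hwa : G.Adj w a <;> by_cases hwb : G.Adj w b <;> by_cases hab' : G.Adj a b <;>
        simp only [hwa, hwb, hab', if_true, if_false, and_self, and_false, false_and] at hsum ⊢
      all_goals
        try have := hne hwa.symm
        try have := hne hwb.symm
        try have := hne hab'
        try have := hne hab'.symm
        omega
    obtain ⟨hwa, hwb, hab'⟩ := hall
    simp only [hwa, hwb, hab', if_true] at hsum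
    have ha0 := hne hwa.symm
    have hb0 := hne hwb.symm
    have fin : ∀ a b, w ≠ a → w ≠ b → G.Adj w a → G.Adj w b → G.Adj a b →
        (G.neighborSet a).ncard = 2 → (G.neighborSet b).ncard = 2 ∨
          ((G.neighborSet b).ncard = 3 ∧ (G.neighborSet w).ncard = k + 1) →
        (G.neighborSet a = {w, b} ∧ G.neighborSet b = {w, a}) ∨
          ((G.neighborSet w).ncard = k + 1 ∧ ∃ z, G.IsEar w a b z) := by
      intro a b hwa' hwb' hwa hwb hab ha hb
      have hNa := neighborSet_eq_pair hwa.symm hab hwb' ha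
      rcases hb with hb | ⟨hb, hw⟩
      · exact Or.inl ⟨hNa, neighborSet_eq_pair hwb.symm hab.symm hwa' hb⟩
      · obtain ⟨z, hzw, hza, hNb⟩ := exists_neighborSet_eq_triple hwb.symm hab.symm hwa' hb
        exact Or.inr ⟨hw, z, hNa, hNb, hzw, hza⟩
    by_cases ha : (G.neighborSet a).ncard = 2
    · exact ⟨a, b, fin a b hwY.1 hwY.2 hwa hwb hab' ha (by omega)⟩
    · exact ⟨b, a, fin b a hwY.2 hwY.1 hwb hwa hab'.symm (by omega) (by omega)⟩

/-! ### Extending colourings -/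

/-- Any two vertices are separated by an edge boundary of size at most `k`, that is, `λ⁺(G) ≤ k`.
-/
def CutBounded (G : SimpleGraph V) (k : ℕ) : Prop :=
  ∀ u v, u ≠ v → ∃ S : Set V, u ∈ S ∧ v ∉ S ∧ (G.edgeCut S).ncard ≤ k

/-- Any two vertices are separated by a rainbow edge boundary, and all stars of size at most `k`
are rainbow. The second property is what makes the induction work: deleting a vertex of an ear
turns its apex into a vertex with a rainbow star. -/
def IsStrongRainbow (G : SimpleGraph V) {k : ℕ} (c : Sym2 V → Fin (k + 1)) : Prop :=
  (∀ v, (G.neighborSet v).ncard ≤ k → G.RainbowAt c v) ∧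
    ∀ u v, u ≠ v → G.RainbowSeparates c u v

theorem CutBounded.mono [Finite V] (h : G.CutBounded k) (hle : H ≤ G) : H.CutBounded k := by
  intro u v huv
  obtain ⟨S, hu, hv, hS⟩ := h u v huv
  exact ⟨S, hu, hv, (Set.ncard_le_ncard (edgeCut_mono hle S) (Set.toFinite _)).trans hS⟩

theorem CutBounded.two_le_of_triangle [Finite V] (h : G.CutBounded k) (hwa : G.Adj w a)
    (hwb : G.Adj w b) (hab : G.Adj a b) : 2 ≤ k := by
  obtain ⟨S, ha, hb, hS⟩ := h a b hab.ne
  refine le_trans ?_ hS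
  by_cases hw : w ∈ S
  · rw [← Set.ncard_pair (show s(a, b) ≠ s(w, b) from mt Sym2.congr_left.1 hwa.ne')]
    refine Set.ncard_le_ncard ?_ (Set.toFinite _)
    rintro e (rfl | rfl)
    · exact ⟨a, ha, b, hb, hab, rfl⟩
    · exact ⟨w, hw, b, hb, hwb, rfl⟩
  · rw [← Set.ncard_pair (show s(a, b) ≠ s(a, w) from mt Sym2.congr_right.1 hwb.ne')]
    refine Set.ncard_le_ncard ?_ (Set.toFinite _)
    rintro e (rfl | rfl)
    · exact ⟨a, ha, b, hb, hab, rfl⟩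
    · exact ⟨a, ha, w, hw, hwa.symm, rfl⟩

theorem ncard_neighborSet_mono [Finite V] (hle : H ≤ G) (v : V) :
    (H.neighborSet v).ncard ≤ (G.neighborSet v).ncard :=
  Set.ncard_le_ncard (fun _ ha => hle ha) (Set.toFinite _)

theorem notMem_sym2 (hx : x ≠ a) (hy : y ≠ a) : a ∉ s(x, y) := by
  simp [hx.symm, hy.symm]

theorem RainbowAt.of_deleteIncidenceSet (h : (G.deleteIncidenceSet a).RainbowAt c v)
    (hc : ∀ e, a ∉ e → c' e = c e) (hva : v ≠ a) (hav : ¬ G.Adj a v) : G.RainbowAt c' v := by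
  have hne : ∀ y, G.Adj v y → y ≠ a := by
    rintro y hy rfl
    exact hav hy.symm
  exact h.of_eq (fun y hy => deleteIncidenceSet_adj.2 ⟨hy, hva, hne y hy⟩)
    fun y hy => hc _ (notMem_sym2 hva (hne y hy))

theorem exists_isStrongRainbow_of_pendant [Finite V] (ha : (G.neighborSet a).ncard = 1)
    {c : Sym2 V → Fin (k + 1)} (h : (G.deleteIncidenceSet a).IsStrongRainbow c) :
    ∃ c' : Sym2 V → Fin (k + 1), G.IsStrongRainbow c' := by
  classical
  obtain ⟨x, hNa⟩ := Set.ncard_eq_one.1 ha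
  have hax : G.Adj a x := show x ∈ G.neighborSet a by simp [hNa]
  have hadj : ∀ y, G.Adj a y → y = x := fun y hy => by
    have : y ∈ G.neighborSet a := hy
    simpa [hNa] using this
  have hle := G.deleteIncidenceSet_le a
  -- If the neighbour `x` of `a` is large, nothing is required of its star and any colour will do.
  obtain ⟨δ, hδ⟩ : ∃ δ, (G.neighborSet x).ncard ≤ k →
      (G.deleteIncidenceSet a).MissesAt c x δ := by
    by_cases hx : (G.neighborSet x).ncard ≤ k
    · obtain ⟨δ, hδ⟩ := exists_missesAt (G.deleteIncidenceSet a) c x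
        (by
          rw [Fintype.card_fin]
          exact Nat.lt_succ_of_le ((ncard_neighborSet_mono hle x).trans hx))
      exact ⟨δ, fun _ => hδ⟩
    · exact ⟨0, fun h => absurd h hx⟩
  have hoff : ∀ e, a ∉ e → Function.update c s(x, a) δ e = c e := by
    intro e he
    refine Function.update_of_ne ?_ _ _
    rintro rfl
    exact he (Sym2.mem_mk_right x a)
  have hstar : G.RainbowAt (Function.update c s(x, a) δ) a := by
    intro p hp q hq _
    rw [hadj p hp, hadj q hq]
  refine ⟨Function.update c s(x, a) δ, ?_, ?_⟩
  · intro v hv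
    by_cases hva : v = a
    · rwa [hva]
    have hHv := h.1 v ((ncard_neighborSet_mono hle v).trans hv)
    by_cases hvx : v = x
    · subst hvx
      refine hHv.update (hδ hv) fun p q hpq hne => deleteIncidenceSet_adj.2 ⟨hpq, ?_, ?_⟩
      · rintro rfl
        exact hne (by rw [hadj q hpq, Sym2.eq_swap])
      · rintro rfl
        exact hne (by rw [hadj p hpq.symm])
    · exact hHv.of_deleteIncidenceSet hoff hva fun hav => hvx (hadj v hav)
  · intro u v huv
    by_cases hua : u = a
    · subst hua
      exact hstar.rainbowSeparates huv
    by_cases hva : v = a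
    · subst hva
      exact (hstar.rainbowSeparates huv.symm).symm
    refine (h.2 u v huv).extend (T := {a}) (w := x) ?_ ?_ hua hva
    · rintro _ rfl y hy
      exact Or.inr (hadj y hy)
    · intro p hp q hq hpq
      exact ⟨deleteIncidenceSet_adj.2 ⟨hpq, hp, hq⟩, hoff _ (notMem_sym2 hp hq)⟩

/-- A triangle `w, a, b` attached to the rest of `G` only at the large vertex `w` can be ignored.
-/
theorem exists_isStrongRainbow_of_triangle [Finite V] (hk : 2 ≤ k)
    (hNa : G.neighborSet a = {w, b}) (hNb : G.neighborSet b = {w, a})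
    (hw : k < (G.neighborSet w).ncard)
    {c : Sym2 V → Fin (k + 1)} (h : (G.deleteIncidenceSet a).IsStrongRainbow c) :
    ∃ c' : Sym2 V → Fin (k + 1), G.IsStrongRainbow c' := by
  classical
  have hmema : ∀ y, G.Adj a y ↔ y = w ∨ y = b := fun y => by
    rw [← mem_neighborSet, hNa]; simp
  have hmemb : ∀ y, G.Adj b y ↔ y = w ∨ y = a := fun y => by
    rw [← mem_neighborSet, hNb]; simp
  have hwa : w ≠ a := ((hmema w).2 (Or.inl rfl)).ne'
  have hwb : w ≠ b := ((hmemb w).2 (Or.inl rfl)).ne'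
  have hab : a ≠ b := ((hmema b).2 (Or.inr rfl)).ne
  obtain ⟨δ, hδ⟩ := exists_notMem_finset (k := k) {c s(b, w)} (by simp; omega)
  obtain ⟨ε, hε⟩ := exists_notMem_finset (k := k) {δ} (by simp; omega)
  rw [Finset.mem_singleton] at hδ hε
  obtain ⟨c', hoff, hc'b, hc'w⟩ := exists_recolor_left (a := a) c δ ε hwb
  have hstara : G.RainbowAt c' a :=
    rainbowAt_of_neighborSet_pair hNa (by rwa [hc'b, hc'w])
  have hstarb : G.RainbowAt c' b := by
    refine rainbowAt_of_neighborSet_pair hNb ?_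
    rw [hoff _ (notMem_sym2 hab.symm hwa), Sym2.eq_swap (a := b) (b := a), hc'b]
    exact Ne.symm hδ
  refine ⟨c', ?_, ?_⟩
  · intro v hv
    by_cases hva : v = a
    · rwa [hva]
    by_cases hvb : v = b
    · rwa [hvb]
    refine (h.1 v ((ncard_neighborSet_mono (G.deleteIncidenceSet_le a) v).trans
      hv)).of_deleteIncidenceSet hoff hva fun hav => ?_
    rcases (hmema v).1 hav with rfl | rfl
    · omega
    · exact hvb rfl
  · intro u v huv
    by_cases hua : u = a
    · exact RainbowAt.rainbowSeparates (hua ▸ hstara) huv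
    by_cases hub : u = b
    · exact RainbowAt.rainbowSeparates (hub ▸ hstarb) huv
    by_cases hva : v = a
    · exact (RainbowAt.rainbowSeparates (hva ▸ hstara) huv.symm).symm
    by_cases hvb : v = b
    · exact (RainbowAt.rainbowSeparates (hvb ▸ hstarb) huv.symm).symm
    refine (h.2 u v huv).extend (T := {a, b}) (w := w) ?_ ?_ (by simp [hua, hub])
      (by simp [hva, hvb])
    · rintro _ (rfl | rfl) y hy
      · rcases (hmema y).1 hy with rfl | rfl <;> simp
      · rcases (hmemb y).1 hy with rfl | rfl <;> simp
    · intro p hp q hq hpq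
      simp only [Set.mem_insert_iff, Set.mem_singleton_iff, not_or] at hp hq
      exact ⟨deleteIncidenceSet_adj.2 ⟨hpq, hp.1, hq.1⟩, hoff _ (notMem_sym2 hp.1 hq.1)⟩

/-- At most one large vertex: of any two vertices, one has a rainbow star. -/
theorem exists_isStrongRainbow_of_subsingleton [Finite V]
    (hsub : ∀ u v, k < (G.neighborSet u).ncard → k < (G.neighborSet v).ncard → u = v) :
    ∃ c : Sym2 V → Fin (k + 1), G.IsStrongRainbow c := by
  obtain ⟨c, hc⟩ := exists_properOff (K := Fin (k + 1)) (I := {v | k < (G.neighborSet v).ncard}) G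
    (fun a ha b hb hab => hab.ne (hsub a b ha hb))
    (fun v hv => by simpa [Nat.lt_succ_iff] using hv)
  have hstar : ∀ v, (G.neighborSet v).ncard ≤ k → G.RainbowAt c v :=
    fun v hv => hc v (not_lt.2 hv)
  refine ⟨c, hstar, fun u v huv => ?_⟩
  by_cases hu : (G.neighborSet u).ncard ≤ k
  · exact (hstar u hu).rainbowSeparates huv
  · refine ((hstar v ?_).rainbowSeparates huv.symm).symm
    by_contra hv
    exact huv (hsub u v (not_le.1 hu) (not_le.1 hv))

theorem IsEar.ncard_left (h : G.IsEar w a b z) : (G.neighborSet a).ncard = 2 := by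
  rw [h.left, Set.ncard_pair h.adj_apex_right.ne]

theorem IsEar.ncard_right (h : G.IsEar w a b z) : (G.neighborSet b).ncard = 3 := by
  rw [h.right]
  exact Set.ncard_eq_three.2 ⟨w, a, z, h.adj_apex_left.ne, h.ne_apex.symm, h.ne_left.symm, rfl⟩

theorem IsEar.rainbowAt_right [Finite V] {c : Sym2 V → Fin (k + 1)} (h : G.IsEar w a b z)
    (hk : 2 ≤ k) (hle : H ≤ G.deleteIncidenceSet a)
    (hc : ∀ v, (H.neighborSet v).ncard ≤ k → H.RainbowAt c v) : H.RainbowAt c b := by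
  refine hc b (le_trans ?_ hk)
  rw [← Set.ncard_pair h.ne_apex.symm]
  refine Set.ncard_le_ncard (fun y hy => ?_) (Set.toFinite _)
  have hy' := deleteIncidenceSet_adj.1 (hle hy)
  rcases h.eq_or_eq_of_adj_right hy'.1 with rfl | rfl | rfl
  · simp
  · exact absurd rfl hy'.2.2
  · simp

theorem IsEar.rainbowAt_apex [Finite V] {c : Sym2 V → Fin (k + 1)} (h : G.IsEar w a b z)
    (hw : (G.neighborSet w).ncard ≤ k + 1) (hle : H ≤ G.deleteIncidenceSet a)
    (hc : ∀ v, (H.neighborSet v).ncard ≤ k → H.RainbowAt c v) : H.RainbowAt c w := by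
  refine hc w (Nat.lt_succ_iff.1 ((Set.ncard_lt_ncard ⟨?_, fun hsub => ?_⟩
    (Set.toFinite _)).trans_le hw))
  · exact fun y hy => (deleteIncidenceSet_adj.1 (hle hy)).1
  · exact (deleteIncidenceSet_adj.1 (hle (hsub h.adj_apex_left))).2.2 rfl

/-- One ear suffices if, outside it, there is at most one large vertex. -/
theorem exists_isStrongRainbow_of_isEar [Finite V] (hk : 2 ≤ k) (h : G.IsEar w a b z)
    (hw : (G.neighborSet w).ncard = k + 1)
    (hlarge : ∀ u v, u ≠ v → u ∉ ({w, a, b} : Set V) → v ∉ ({w, a, b} : Set V) →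
      (G.neighborSet u).ncard ≤ k ∨ (G.neighborSet v).ncard ≤ k)
    {c : Sym2 V → Fin (k + 1)} (hc : (G.deleteIncidenceSet a).IsStrongRainbow c) :
    ∃ c' : Sym2 V → Fin (k + 1), G.IsStrongRainbow c' := by
  obtain ⟨c', hoff, ha, hb, S, hSsub, hwS, hS⟩ := h.exists_extension hk hw.le
    (h.rainbowAt_apex hw.le le_rfl hc.1) (h.rainbowAt_right hk le_rfl hc.1)
  have hstar : ∀ v, (G.neighborSet v).ncard ≤ k → G.RainbowAt c' v := by
    intro v hv
    by_cases hva : v = a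
    · rwa [hva]
    by_cases hvb : v = b
    · rwa [hvb]
    refine (hc.1 v ((ncard_neighborSet_mono (G.deleteIncidenceSet_le a) v).trans
      hv)).of_deleteIncidenceSet hoff hva fun hav => ?_
    rcases h.eq_or_eq_of_adj_left hav with rfl | rfl
    · omega
    · exact hvb rfl
  have hmem : ∀ u v, u ≠ v → u ∈ ({w, a, b} : Set V) → G.RainbowSeparates c' u v := by
    intro u v huv hu
    by_cases hva : v = a
    · exact (RainbowAt.rainbowSeparates (hva ▸ ha) huv.symm).symm
    by_cases hvb : v = b
    · exact (RainbowAt.rainbowSeparates (hvb ▸ hb) huv.symm).symm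
    rcases hu with rfl | rfl | rfl
    · refine ⟨S, hS, hwS, fun hvS => ?_⟩
      rcases hSsub hvS with rfl | rfl | rfl <;> contradiction
    · exact ha.rainbowSeparates huv
    · exact hb.rainbowSeparates huv
  refine ⟨c', hstar, fun u v huv => ?_⟩
  by_cases hu : u ∈ ({w, a, b} : Set V)
  · exact hmem u v huv hu
  by_cases hv : v ∈ ({w, a, b} : Set V)
  · exact (hmem v u huv.symm hv).symm
  rcases hlarge u v huv hu hv with hu | hv
  · exact (hstar u hu).rainbowSeparates huv
  · exact ((hstar v hv).rainbowSeparates huv.symm).symm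

/-- A second ear with its apex outside `{w, a, b}` is disjoint from the first ear. -/
theorem IsEar.notMem_of_isEar {a' b' z' : V} (hk : 2 ≤ k) (h : G.IsEar w a b z)
    (hw : (G.neighborSet w).ncard = k + 1) (h' : G.IsEar u a' b' z')
    (hu : u ∉ ({w, a, b} : Set V)) :
    a' ∉ ({w, a, b} : Set V) ∧ b' ∉ ({w, a, b} : Set V) := by
  simp only [Set.mem_insert_iff, Set.mem_singleton_iff, not_or] at hu ⊢
  have ha'w : a' ≠ w := by
    rintro rfl
    have := h'.ncard_left
    omega
  have ha'a : a' ≠ a := by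
    rintro rfl
    rcases h.eq_or_eq_of_adj_left h'.adj_apex_left.symm with rfl | rfl
    · exact hu.1 rfl
    · exact hu.2.2 rfl
  have ha'b : a' ≠ b := by
    rintro rfl
    have := h'.ncard_left
    have := h.ncard_right
    omega
  refine ⟨⟨ha'w, ha'a, ha'b⟩, ?_, ?_, ?_⟩
  · rintro rfl
    rcases h'.eq_or_eq_of_adj_right h.adj_apex_left with rfl | rfl | rfl
    · exact hu.2.1 rfl
    · exact ha'a rfl
    rcases h'.eq_or_eq_of_adj_right h.adj_apex_right with rfl | rfl | h3
    · exact hu.2.2 rfl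
    · exact ha'b rfl
    · exact h.adj_left_right.ne h3.symm
  · rintro rfl
    have := h'.ncard_right
    have := h.ncard_left
    omega
  · rintro rfl
    have huz : u = z := by
      rcases h.eq_or_eq_of_adj_right h'.adj_apex_right.symm with h1 | h1 | h1
      · exact absurd h1 hu.1
      · exact absurd h1 hu.2.1
      · exact h1
    rcases h.eq_or_eq_of_adj_right h'.adj_left_right.symm with h1 | h1 | h1
    · exact ha'w h1
    · exact ha'a h1
    · exact h'.adj_apex_left.ne (huz.trans h1.symm)

/-- With two disjoint ears on at most seven vertices, all vertices but at most one are separated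
from every other vertex by a star or by a boundary from `IsEar.exists_extension`. -/
theorem exists_isStrongRainbow_of_two_ears [Fintype V] (hV : Fintype.card V ≤ 7) (hk : 2 ≤ k)
    {a' b' z' : V} (h : G.IsEar w a b z) (hw : (G.neighborSet w).ncard = k + 1)
    (h' : G.IsEar u a' b' z') (hu : (G.neighborSet u).ncard = k + 1)
    (huw : u ∉ ({w, a, b} : Set V)) {c : Sym2 V → Fin (k + 1)}
    (hc : ((G.deleteIncidenceSet a).deleteIncidenceSet a').IsStrongRainbow c) :
    ∃ c' : Sym2 V → Fin (k + 1), G.IsStrongRainbow c' := by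
  classical
  obtain ⟨ha'mem, hb'mem⟩ := h.notMem_of_isEar hk hw h' huw
  simp only [Set.mem_insert_iff, Set.mem_singleton_iff, not_or] at ha'mem hb'mem huw
  have hnot : ∀ y, y = u ∨ y = a' ∨ y = b' → ¬ G.Adj a y := by
    rintro y hy hay
    rcases h.eq_or_eq_of_adj_left hay with rfl | rfl <;> rcases hy with rfl | rfl | rfl <;>
      simp_all
  have hN : ∀ y, y = u ∨ y = a' ∨ y = b' →
      (G.deleteIncidenceSet a).neighborSet y = G.neighborSet y := by
    intro y hy
    ext p
    rw [mem_neighborSet, mem_neighborSet, deleteIncidenceSet_adj]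
    refine ⟨fun hp => hp.1, fun hp => ⟨hp, ?_, ?_⟩⟩
    · rintro rfl
      rcases hy with rfl | rfl | rfl
      · exact huw.2.1 rfl
      · exact ha'mem.2.1 rfl
      · exact hb'mem.2.1 rfl
    · rintro rfl
      exact hnot y hy hp.symm
  have hear : (G.deleteIncidenceSet a).IsEar u a' b' z' :=
    ⟨by rw [hN _ (by simp), h'.left], by rw [hN _ (by simp), h'.right], h'.ne_apex, h'.ne_left⟩
  have hu' : ((G.deleteIncidenceSet a).neighborSet u).ncard ≤ k + 1 := by
    rw [hN _ (by simp), hu]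
  set H := G.deleteIncidenceSet a with hH
  have hHG : H ≤ G := G.deleteIncidenceSet_le a
  have hle : H.deleteIncidenceSet a' ≤ H := H.deleteIncidenceSet_le a'
  obtain ⟨d, hoffd, ha'd, hb'd, S', hS'sub, huS', hS'⟩ := hear.exists_extension hk hu'
    (hear.rainbowAt_apex hu' le_rfl hc.1) (hear.rainbowAt_right hk le_rfl hc.1)
  have hnot' : ∀ y, y ≠ u → y ≠ b' → ¬ H.Adj a' y := by
    intro y hyu hyb hay
    rcases hear.eq_or_eq_of_adj_left hay with rfl | rfl <;> contradiction
  have hwd : H.RainbowAt d w := (h.rainbowAt_apex hw.le hle hc.1).of_deleteIncidenceSet hoffd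
    (Ne.symm ha'mem.1) (hnot' w (Ne.symm huw.1) (Ne.symm hb'mem.1))
  have hbd : H.RainbowAt d b := (h.rainbowAt_right hk hle hc.1).of_deleteIncidenceSet hoffd
    (Ne.symm ha'mem.2.2) (hnot' b (Ne.symm huw.2.2) (Ne.symm hb'mem.2.2))
  obtain ⟨c', hoff, ha, hb, S, hSsub, hwS, hS⟩ := h.exists_extension hk hw.le hwd hbd
  have ha' : G.RainbowAt c' a' := ha'd.of_deleteIncidenceSet hoff ha'mem.2.1 (hnot _ (by simp))
  have hb' : G.RainbowAt c' b' := hb'd.of_deleteIncidenceSet hoff hb'mem.2.1 (hnot _ (by simp))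
  -- No neighbour of `a` lies in the second ear, so the boundary of `S'` is unaffected by `a`.
  have hS'c : Set.InjOn c' (G.edgeCut S') := by
    refine injOn_of_subset_edgeCut hS' fun p hp q hq hpq => ?_
    have hp' : p = u ∨ p = a' ∨ p = b' := hS'sub hp
    have hpa : p ≠ a := by
      rintro rfl
      rcases hp' with rfl | rfl | rfl
      · exact huw.2.1 rfl
      · exact ha'mem.2.1 rfl
      · exact hb'mem.2.1 rfl
    have hqa : q ≠ a := by
      rintro rfl
      exact hnot p hp' hpq.symm
    exact ⟨hp, hq, deleteIncidenceSet_adj.2 ⟨hpq, hpa, hqa⟩, hoff _ (notMem_sym2 hpa hqa)⟩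
  let T : Finset V := {a, b, a', b', w, u}
  have hT : T.card = 6 := by
    have h1 := h.adj_apex_left.ne
    have h2 := h.adj_apex_right.ne
    have h3 := h.adj_left_right.ne
    have h4 := h'.adj_apex_left.ne
    have h5 := h'.adj_apex_right.ne
    have h6 := h'.adj_left_right.ne
    simp [T, Finset.card_insert_of_notMem, h1.symm, h2.symm, h3, h4.symm, h5.symm, h6, ha'mem.1,
      Ne.symm ha'mem.2.1, Ne.symm ha'mem.2.2, hb'mem.1, Ne.symm hb'mem.2.1, Ne.symm hb'mem.2.2,
      Ne.symm huw.1, Ne.symm huw.2.1, Ne.symm huw.2.2]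
  have hout : ∀ p q, p ∉ T → q ∉ T → p = q := by
    intro p q hp hq
    by_contra hpq
    have := Finset.card_le_univ (insert p (insert q T))
    rw [Finset.card_insert_of_notMem (by simp [hpq, hp]), Finset.card_insert_of_notMem hq,
      hT] at this
    omega
  have hsep : ∀ p ∈ T, ∀ q, p ≠ q → G.RainbowSeparates c' p q := by
    intro p hp q hpq
    have hq : ∀ r, G.RainbowAt c' r → q = r → G.RainbowSeparates c' p q := by
      rintro r hr rfl
      exact (hr.rainbowSeparates hpq.symm).symm
    by_cases hqa : q = a
    · exact hq a ha hqa
    by_cases hqb : q = b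
    · exact hq b hb hqb
    by_cases hqa' : q = a'
    · exact hq a' ha' hqa'
    by_cases hqb' : q = b'
    · exact hq b' hb' hqb'
    simp only [T, Finset.mem_insert, Finset.mem_singleton] at hp
    rcases hp with rfl | rfl | rfl | rfl | rfl | rfl
    · exact ha.rainbowSeparates hpq
    · exact hb.rainbowSeparates hpq
    · exact ha'.rainbowSeparates hpq
    · exact hb'.rainbowSeparates hpq
    · refine ⟨S, hS, hwS, fun hqS => ?_⟩
      rcases hSsub hqS with rfl | rfl | rfl <;> contradiction
    · refine ⟨S', hS'c, huS', fun hqS => ?_⟩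
      rcases hS'sub hqS with rfl | rfl | rfl <;> contradiction
  refine ⟨c', fun v hv => ?_, fun p q hpq => ?_⟩
  · by_cases hva : v = a
    · rwa [hva]
    by_cases hvb : v = b
    · rwa [hvb]
    by_cases hva' : v = a'
    · rwa [hva']
    by_cases hvb' : v = b'
    · rwa [hvb']
    have hvw : v ≠ w := by
      rintro rfl
      omega
    have hvu : v ≠ u := by
      rintro rfl
      omega
    refine RainbowAt.of_deleteIncidenceSet (RainbowAt.of_deleteIncidenceSet (hc.1 v
      ((ncard_neighborSet_mono (hle.trans hHG) v).trans hv)) hoffd hva' (hnot' v hvu hvb'))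
      hoff hva fun hav => ?_
    rcases h.eq_or_eq_of_adj_left hav with rfl | rfl <;> contradiction
  · by_cases hp : p ∈ T
    · exact hsep p hp q hpq
    by_cases hq : q ∈ T
    · exact (hsep q hq p hpq.symm).symm
    exact absurd (hout p q hp hq) hpq

/-! ### Graphs with at most seven vertices -/

/-- One side of a small cut between two large vertices has at most three vertices. -/
theorem CutBounded.exists_ear [Fintype V] (hV : Fintype.card V ≤ 7) (hG : G.CutBounded k)
    (hpend : ∀ v, (G.neighborSet v).ncard ≠ 1)
    (htri : ∀ w a b, k < (G.neighborSet w).ncard → G.neighborSet a = {w, b} →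
      G.neighborSet b ≠ {w, a})
    (huv : u ≠ v) (hu : k < (G.neighborSet u).ncard) (hv : k < (G.neighborSet v).ncard) :
    ∃ w, (w = u ∨ w = v) ∧ (G.neighborSet w).ncard = k + 1 ∧ ∃ a b z, G.IsEar w a b z := by
  classical
  obtain ⟨S, huS, hvS, hS⟩ := hG u v huv
  have key : ∀ (w : V) (X : Finset V), X.card ≤ 3 → w ∈ X → k < (G.neighborSet w).ncard →
      (G.edgeCut X).ncard ≤ k → (G.neighborSet w).ncard = k + 1 ∧ ∃ a b z, G.IsEar w a b z := by
    intro w X hX hwX hw hcut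
    obtain ⟨a, b, hab | ⟨hw', z, hz⟩⟩ := exists_triangle_of_edgeCut_le hX hwX hw hcut hpend
    · exact absurd hab.2 (htri w a b hw hab.1)
    · exact ⟨hw', a, b, z, hz⟩
  by_cases hX : S.toFinset.card ≤ 3
  · exact ⟨u, Or.inl rfl, key u S.toFinset hX (by simpa using huS) hu (by simpa using hS)⟩
  · refine ⟨v, Or.inr rfl, key v (S.toFinset)ᶜ ?_ (by simpa using hvS) hv ?_⟩
    · rw [Finset.card_compl]
      omega
    · rw [Finset.coe_compl, edgeCut_compl]
      simpa using hS

theorem ncard_edgeSet_deleteIncidenceSet_lt [Finite V] (h : G.Adj a b) :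
    (G.deleteIncidenceSet a).edgeSet.ncard < G.edgeSet.ncard := by
  refine Set.ncard_lt_ncard ⟨edgeSet_mono (G.deleteIncidenceSet_le a), fun hsub => ?_⟩
    (Set.toFinite _)
  have : (G.deleteIncidenceSet a).Adj a b := hsub (show s(a, b) ∈ G.edgeSet from h)
  exact (deleteIncidenceSet_adj.1 this).2.1 rfl

theorem CutBounded.exists_isStrongRainbow [Fintype V] (hV : Fintype.card V ≤ 7)
    (hG : G.CutBounded k) : ∃ c : Sym2 V → Fin (k + 1), G.IsStrongRainbow c := by
  induction hn : G.edgeSet.ncard using Nat.strong_induction_on generalizing G with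
  | _ n ih =>
    subst hn
    have step : ∀ {a b}, G.Adj a b →
        ∃ c : Sym2 V → Fin (k + 1), (G.deleteIncidenceSet a).IsStrongRainbow c := fun {a b} hab =>
      ih _ (ncard_edgeSet_deleteIncidenceSet_lt hab) (hG.mono (G.deleteIncidenceSet_le a)) rfl
    by_cases hpend : ∃ a, (G.neighborSet a).ncard = 1
    · obtain ⟨a, ha⟩ := hpend
      obtain ⟨x, hx⟩ := Set.ncard_eq_one.1 ha
      obtain ⟨c, hc⟩ := step (show x ∈ G.neighborSet a by simp [hx])
      exact exists_isStrongRainbow_of_pendant ha hc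
    by_cases htri : ∃ w a b, k < (G.neighborSet w).ncard ∧ G.neighborSet a = {w, b} ∧
        G.neighborSet b = {w, a}
    · obtain ⟨w, a, b, hw, ha, hb⟩ := htri
      have haw : G.Adj a w := show w ∈ G.neighborSet a by simp [ha]
      have hbw : G.Adj b w := show w ∈ G.neighborSet b by simp [hb]
      have hab : G.Adj a b := show b ∈ G.neighborSet a by simp [ha]
      obtain ⟨c, hc⟩ := step haw
      exact exists_isStrongRainbow_of_triangle (hG.two_le_of_triangle haw.symm hbw.symm hab)
        ha hb hw hc
    push Not at hpend htri
    by_cases hsub : ∀ u v, k < (G.neighborSet u).ncard → k < (G.neighborSet v).ncard → u = v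
    · exact exists_isStrongRainbow_of_subsingleton hsub
    push Not at hsub
    obtain ⟨u, v, hu, hv, huv⟩ := hsub
    obtain ⟨w, -, hw, a, b, z, h⟩ := hG.exists_ear hV hpend htri huv hu hv
    have hk := hG.two_le_of_triangle h.adj_apex_left h.adj_apex_right h.adj_left_right
    by_cases hlarge : ∀ u v, u ≠ v → u ∉ ({w, a, b} : Set V) → v ∉ ({w, a, b} : Set V) →
        (G.neighborSet u).ncard ≤ k ∨ (G.neighborSet v).ncard ≤ k
    · obtain ⟨c, hc⟩ := step h.adj_apex_left.symm
      exact exists_isStrongRainbow_of_isEar hk h hw hlarge hc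
    push Not at hlarge
    obtain ⟨p, q, hpq, hp, hq, hpk, hqk⟩ := hlarge
    obtain ⟨r, hr, hrk, a', b', z', h'⟩ := hG.exists_ear hV hpend htri hpq hpk hqk
    have hrmem : r ∉ ({w, a, b} : Set V) := by
      rcases hr with rfl | rfl <;> assumption
    have hle := (G.deleteIncidenceSet a).deleteIncidenceSet_le a'
    obtain ⟨c, hc⟩ := ih _ ((Set.ncard_le_ncard (edgeSet_mono hle) (Set.toFinite _)).trans_lt
      (ncard_edgeSet_deleteIncidenceSet_lt h.adj_apex_left.symm))
      (hG.mono (hle.trans (G.deleteIncidenceSet_le a))) rfl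
    exact exists_isStrongRainbow_of_two_ears hV hk h hw h' hrk hrmem hc

/-! ### Separating edge sets and edge boundaries -/

theorem EdgeSeparates.exists_edgeCut_subset {F : Set G.edgeSet} (h : G.EdgeSeparates F u v) :
    ∃ S : Set V, u ∈ S ∧ v ∉ S ∧ G.edgeCut S ⊆ Subtype.val '' F := by
  refine ⟨{x | (G.deleteEdges (Subtype.val '' F)).Reachable u x}, Reachable.refl u, h, ?_⟩
  rintro _ ⟨x, hx, y, hy, hxy, rfl⟩
  by_contra hF
  exact hy (Reachable.trans hx (Adj.reachable (deleteEdges_adj.2 ⟨hxy, hF⟩)))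

theorem edgeSeparates_of_edgeCut {S : Set V} (hu : u ∈ S) (hv : v ∉ S) :
    G.EdgeSeparates (Subtype.val ⁻¹' G.edgeCut S) u v := by
  intro hreach
  rw [reachable_iff_reflTransGen] at hreach
  induction hreach with
  | refl => exact hv hu
  | @tail x y _ hxy ih =>
    rw [deleteEdges_adj] at hxy
    exact ih fun hx => hxy.2 ⟨⟨s(x, y), hxy.1⟩, ⟨x, hx, y, hv, hxy.1, rfl⟩, rfl⟩

theorem cutBounded_upperEdgeConn [Finite V] (G : SimpleGraph V) :
    G.CutBounded G.upperEdgeConn := by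
  intro u v huv
  obtain ⟨F, hF, hsep⟩ := G.localEdgeConn_spec huv
  obtain ⟨S, hu, hv, hS⟩ := hsep.exists_edgeCut_subset
  refine ⟨S, hu, hv, ?_⟩
  calc (G.edgeCut S).ncard ≤ (Subtype.val '' (F : Set G.edgeSet)).ncard :=
        Set.ncard_le_ncard hS (Set.toFinite _)
    _ ≤ F.card := by
        rw [← Set.ncard_coe_finset]
        exact Set.ncard_image_le (Set.toFinite _)
    _ ≤ G.upperEdgeConn := hF.trans_le (G.localEdgeConn_le_upperEdgeConn huv)

theorem isRainbowDisconnection_of_rainbowSeparates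
    (h : ∀ u v, u ≠ v → G.RainbowSeparates c u v) :
    IsRainbowDisconnection fun e : G.edgeSet => c e := by
  intro u v huv
  obtain ⟨S, hS, hu, hv⟩ := h u v huv
  exact ⟨_, fun e he e' he' heq => Subtype.ext (hS he he' heq), edgeSeparates_of_edgeCut hu hv⟩


end SimpleGraph

theorem mainTheorem9 {V : Type*} [Fintype V] (G : SimpleGraph V) (hn : Fintype.card V ≤ 7) :
    G.rainbowDisconnectionNumber ≤ G.upperEdgeConn + 1 := by
  obtain ⟨c, hc⟩ := G.cutBounded_upperEdgeConn.exists_isStrongRainbow hn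
  exact Nat.sInf_le ⟨fun e => c e, SimpleGraph.isRainbowDisconnection_of_rainbowSeparates hc.2⟩
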